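/- Let $n\ge 0$ be an integer. For a partition $\lambda$, let $|\lambda|$ be the sum of its parts, $\lambda'$ its conjugate, and $d(\lambda)$ the side of its Durfee square, i.e. the largest $d$ such that a $d\times d$ square fits in the Ferrers diagram of $\lambda$. For $1\le i\le d(\lambda)$ the $i$th rank of $\lambda$ is $r_i(\lambda)=\lambda_i-\lambda_i'$. Let $R_n$ be the set of all partitions $\lambda$ (including the empty one) whose Ferrers diagram is contained in an $n\times n$ square and which satisfy $r_i(\lambda)<0$ for all $1\le i\le d(\lambda)$. For a word $w=a_1a_2\cdots a_\ell$ of positive integers put $\operatorname{Des} w=\{i : 1\le i<\ell,\ a_i>a_{i+1}\}$, $\operatorname{maj} w=\sum_{i\in\operatorname{Des} w} i$ and $\operatorname{des} w=|\operatorname{Des} w|$. The word $w$ is a ballot sequence if, for every prefix $v$ of $w$ and every positive integer $i$, the number of $i$'s in $v$ is at least the number of $(i+1)$'s in $v$. Let $B_n$ be the set of ballot sequences that are rearrangements of the word $1^n2^n$ ($n$ ones and $n$ twos), and let $$c_n(q,t)=\sum_{w\in B_n}q^{\operatorname{maj} w}\,t^{\operatorname{des} w}$$ be the Fürlinger–Hofbauer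 $q,t$-Catalan polynomial. Then, in $\mathbb{Z}[q,t]$, $$\sum_{\lambda\in R_n}q^{|\lambda|}\,t^{d(\lambda)}=c_n(q,t).$$ In particular, in the field $\mathbb{Q}(q)$, $$\sum_{\lambda\in R_n}q^{|\lambda|}=\frac{1}{[n+1]}\begin{bmatrix}2n\\ n\end{bmatrix},$$ where $[m]=1+q+\cdots+q^{m-1}$, $[m]!=[1][2]\cdots[m]$ and $\begin{bmatrix}m\\ k\end{bmatrix}=\dfrac{[m]!}{[k]!\,[m-k]!}$. -/

import Mathlib

namespace QTCatalan

/-! ### Words over the positive integers -/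

/-- The descent set `Des w = {i : 1 ≤ i < l(w), aᵢ > aᵢ₊₁}` of a word `w = a₁ a₂ … aₗ`.
The letter `aᵢ` is the list entry with (zero-based) index `i - 1`, so the default value of
`getD` is never used. -/
def Des (w : List ℕ+) : Finset ℕ :=
  {i ∈ Finset.Ico 1 w.length | w.getD (i - 1) 1 > w.getD i 1}

/-- The major index: the sum of the descents. -/
def maj (w : List ℕ+) : ℕ := ∑ i ∈ Des w, i

/-- The descent number. -/
def des (w : List ℕ+) : ℕ := (Des w).card

/-- A ballot sequence: in every prefix there are at least as many `i`'s as `(i+1)`'s, for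
every positive integer `i`. -/
def IsBallot (w : List ℕ+) : Prop :=
  ∀ v : List ℕ+, v <+: w → ∀ i : ℕ+, v.count (i + 1) ≤ v.count i

open Classical in
/-- `B_n`: the ballot sequences among the rearrangements of the word `1ⁿ 2ⁿ`. -/
noncomputable def B (n : ℕ) : Finset (List ℕ+) :=
  {w ∈ (List.replicate n (1 : ℕ+) ++ List.replicate n 2).permutations.toFinset | IsBallot w}

theorem mem_B {n : ℕ} {w : List ℕ+} :
    w ∈ B n ↔ w.Perm (List.replicate n (1 : ℕ+) ++ List.replicate n 2) ∧ IsBallot w := by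
  simp [B]

/-- The variable `q` of the polynomial ring `ℤ[q,t]`. -/
noncomputable def q : MvPolynomial (Fin 2) ℤ := MvPolynomial.X 0

/-- The variable `t` of the polynomial ring `ℤ[q,t]`. -/
noncomputable def t : MvPolynomial (Fin 2) ℤ := MvPolynomial.X 1

/-- The Fürlinger–Hofbauer polynomial `c_n(q,t) = ∑_{w ∈ B_n} q^{maj w} t^{des w}`. -/
noncomputable def c (n : ℕ) : MvPolynomial (Fin 2) ℤ :=
  ∑ w ∈ B n, q ^ maj w * t ^ des w

/-! ### Partitions, as Young (Ferrers) diagrams -/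

/-- The rectangular diagram with `m` rows and `n` columns. -/
def rectangle (m n : ℕ) : YoungDiagram where
  cells := Finset.range m ×ˢ Finset.range n
  isLowerSet := by
    rintro ⟨a, b⟩ ⟨a', b'⟩ h h'
    have := Prod.mk_le_mk.mp h
    simp only [Finset.coe_product, Finset.coe_range, Set.mem_prod, Set.mem_Iio] at h' ⊢
    omega

/-- The side of the Durfee square: the largest `d` such that the `d × d` square is contained
in the diagram. -/
noncomputable def durfee (μ : YoungDiagram) : ℕ := sSup {d | rectangle d d ≤ μ}

theorem isGreatest_durfee (μ : YoungDiagram) :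
    IsGreatest {d | rectangle d d ≤ μ} (durfee μ) := by
  have hb : BddAbove {d | rectangle d d ≤ μ} := by
    refine ⟨μ.card, fun d (hd : rectangle d d ≤ μ) => ?_⟩
    have h := Finset.card_le_card (YoungDiagram.cells_subset_iff.mpr hd)
    simp only [rectangle, Finset.card_product, Finset.card_range] at h
    exact (Nat.le_mul_self d).trans h
  have h0 : (0 : ℕ) ∈ {d | rectangle d d ≤ μ} := by
    rw [Set.mem_ofPred_eq, ← YoungDiagram.cells_subset_iff]
    simp [rectangle]
  exact ⟨Nat.sSup_mem ⟨0, h0⟩ hb, fun d hd => le_csSup hb hd⟩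

/-- The `i`-th rank `r_i = λ_i - λ'_i`, for `i ≥ 1`; rows and columns of a `YoungDiagram` are
indexed from `0`. -/
def rank (μ : YoungDiagram) (i : ℕ) : ℤ :=
  (μ.rowLen (i - 1) : ℤ) - (μ.transpose.rowLen (i - 1) : ℤ)

/-- The partitions contained in an `n × n` box all of whose ranks are negative. -/
def NegRanks (n : ℕ) : Set YoungDiagram :=
  {μ | μ ≤ rectangle n n ∧ ∀ i, 1 ≤ i → i ≤ durfee μ → rank μ i < 0}

theorem finite_negRanks (n : ℕ) : (NegRanks n).Finite := by
  refine Set.Finite.of_finite_image (f := YoungDiagram.cells)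
    ((rectangle n n).cells.powerset.finite_toSet.subset ?_)
    (fun μ _ ν _ h => YoungDiagram.ext h)
  rintro _ ⟨μ, hμ, rfl⟩
  exact Finset.mem_coe.mpr (Finset.mem_powerset.mpr (YoungDiagram.cells_subset_iff.mpr hμ.1))

/-- `R_n`, as a finite set. -/
noncomputable def R (n : ℕ) : Finset YoungDiagram := (finite_negRanks n).toFinset

theorem mem_R {n : ℕ} {μ : YoungDiagram} :
    μ ∈ R n ↔ μ ≤ rectangle n n ∧ ∀ i, 1 ≤ i → i ≤ durfee μ → rank μ i < 0 := by
  simp [R, NegRanks]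

/-! ### `q`-analogues in the field `ℚ(q)` -/

/-- `[n] = 1 + q + ⋯ + q^{n-1}`. -/
noncomputable def qNumber (n : ℕ) : RatFunc ℚ := ∑ i ∈ Finset.range n, RatFunc.X ^ i

/-- `[n]! = [1] [2] ⋯ [n]`. -/
noncomputable def qFactorial (n : ℕ) : RatFunc ℚ := ∏ i ∈ Finset.Icc 1 n, qNumber i

/-- The Gaussian binomial coefficient `[n]! / ([k]! [n-k]!)`, for `k ≤ n`. -/
noncomputable def qBinomial (n k : ℕ) : RatFunc ℚ :=
  qFactorial n / (qFactorial k * qFactorial (n - k))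

end QTCatalan

namespace QTCatalan

/-! ### Diagrams with negative ranks in a box -/

/-! Both sides are the diagonal case of two-parameter families: diagrams with negative ranks in an
`a × b` box, and ballot words with `a` ones and `b` twos. For `b < a` each generating function
satisfies `F(a+1,b+1) = F(a,b+1) + F(a+1,b) + (q^(a+b+1) t - 1) F(a,b)`, with `F(a,0) = 1` and
`F(b+1,b+1) = F(b+1,b)`, and these data determine `F` for `b ≤ a` (`eq_of_recurrence`).

For diagrams (`boxSum_succ_succ`), inclusion-exclusion counts those missing the last row or the last
column; the others lose their outer hook of `a + b + 1` cells, which lowers the Durfee side by one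
and shifts the remaining ranks. For words (`ballotSum_succ_succ`), delete the last letter: a final 2
creates no descent, and a final 1 creates one exactly after a 2.

At `t = 1` the same recurrence is solved by explicit `q`-ballot numbers (`qBallot_succ_succ`), whose
diagonal values are the `q`-Catalan numbers. -/

theorem mem_rectangle {m n i j : ℕ} : (i, j) ∈ rectangle m n ↔ i < m ∧ j < n := by
  rw [← YoungDiagram.mem_cells]
  simp [rectangle]

theorem diag_mem_iff {μ : YoungDiagram} {i : ℕ} : (i, i) ∈ μ ↔ i < durfee μ := by
  constructor
  · intro h
    refine Nat.lt_of_succ_le ((isGreatest_durfee μ).2 ?_)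
    rintro ⟨x, y⟩ hxy
    rw [mem_rectangle] at hxy
    exact μ.up_left_mem (by omega) (by omega) h
  · intro h
    exact (isGreatest_durfee μ).1 (mem_rectangle.2 ⟨h, h⟩)

theorem le_rectangle_iff {μ : YoungDiagram} {m n : ℕ} :
    μ ≤ rectangle m n ↔ (m, 0) ∉ μ ∧ (0, n) ∉ μ := by
  constructor
  · intro h
    constructor <;> intro h' <;> have := mem_rectangle.1 (h h') <;> omega
  · rintro ⟨h1, h2⟩ ⟨i, j⟩ hij
    rw [mem_rectangle]
    constructor
    · by_contra! hi
      exact h1 (μ.up_left_mem hi (Nat.zero_le _) hij)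
    · by_contra! hj
      exact h2 (μ.up_left_mem (Nat.zero_le _) hj hij)

theorem finite_le_rectangle (m n : ℕ) : {μ | μ ≤ rectangle m n}.Finite := by
  refine Set.Finite.of_finite_image (f := YoungDiagram.cells)
    ((rectangle m n).cells.powerset.finite_toSet.subset ?_)
    (fun μ _ ν _ h => YoungDiagram.ext h)
  rintro _ ⟨μ, hμ, rfl⟩
  exact Finset.mem_coe.mpr (Finset.mem_powerset.mpr (YoungDiagram.cells_subset_iff.mpr hμ))

open Classical in
/-- The diagrams inside a box with `a` rows and `b` columns all of whose ranks are negative. -/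
noncomputable def negRankBox (a b : ℕ) : Finset YoungDiagram :=
  {μ ∈ (finite_le_rectangle a b).toFinset | ∀ i, (i, i) ∈ μ → μ.rowLen i < μ.colLen i}

theorem mem_negRankBox {a b : ℕ} {μ : YoungDiagram} :
    μ ∈ negRankBox a b ↔
      ((a, 0) ∉ μ ∧ (0, b) ∉ μ) ∧ ∀ i, (i, i) ∈ μ → μ.rowLen i < μ.colLen i := by
  simp [negRankBox, ← le_rectangle_iff]

theorem R_eq_negRankBox (n : ℕ) : R n = negRankBox n n := by
  ext μ
  rw [mem_R, mem_negRankBox, le_rectangle_iff]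
  refine and_congr_right fun _ => ?_
  constructor
  · intro h i hi
    have := h (i + 1) (by omega) (by have := diag_mem_iff.1 hi; omega)
    simp only [rank, Nat.add_sub_cancel, YoungDiagram.rowLen_transpose] at this
    omega
  · intro h i hi hid
    have := h (i - 1) (diag_mem_iff.2 (by omega))
    simp only [rank, YoungDiagram.rowLen_transpose]
    omega

/-- Prepend a hook with `a + 1` rows and `b + 1` columns to a diagram. -/
def addHook (a b : ℕ) (μ : YoungDiagram) : YoungDiagram where
  cells := {p ∈ Finset.range (a + 1) ×ˢ Finset.range (b + 1) |
    p.1 = 0 ∨ p.2 = 0 ∨ (p.1 - 1, p.2 - 1) ∈ μ}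
  isLowerSet := by
    rintro ⟨i, j⟩ ⟨i', j'⟩ h h'
    have := Prod.mk_le_mk.mp h
    simp only [Finset.coe_filter, Finset.mem_product, Finset.mem_range, Set.mem_ofPred_eq] at h' ⊢
    refine ⟨by omega, ?_⟩
    rcases h'.2 with h0 | h0 | h0
    · omega
    · omega
    · exact Or.inr (Or.inr (μ.up_left_mem (by omega) (by omega) h0))

theorem mem_addHook {a b i j : ℕ} {μ : YoungDiagram} :
    (i, j) ∈ addHook a b μ ↔
      (i < a + 1 ∧ j < b + 1) ∧ (i = 0 ∨ j = 0 ∨ (i - 1, j - 1) ∈ μ) := by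
  rw [← YoungDiagram.mem_cells]
  simp [addHook]

/-- Remove the first row and the first column. -/
def removeHook (μ : YoungDiagram) : YoungDiagram where
  cells := {p ∈ μ.cells | (p.1 + 1, p.2 + 1) ∈ μ}
  isLowerSet := by
    rintro ⟨i, j⟩ ⟨i', j'⟩ h h'
    have := Prod.mk_le_mk.mp h
    simp only [Finset.coe_filter, YoungDiagram.mem_cells, Set.mem_ofPred_eq] at h' ⊢
    exact ⟨μ.up_left_mem (by omega) (by omega) h'.1, μ.up_left_mem (by omega) (by omega) h'.2⟩

theorem mem_removeHook {i j : ℕ} {μ : YoungDiagram} :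
    (i, j) ∈ removeHook μ ↔ (i + 1, j + 1) ∈ μ := by
  rw [← YoungDiagram.mem_cells]
  simp only [removeHook, Finset.mem_filter, YoungDiagram.mem_cells, and_iff_right_iff_imp]
  exact μ.up_left_mem (by omega) (by omega)

theorem lt_of_mem {a b i j : ℕ} {μ : YoungDiagram} (h : (a, 0) ∉ μ ∧ (0, b) ∉ μ)
    (hij : (i, j) ∈ μ) : i < a ∧ j < b :=
  mem_rectangle.1 (le_rectangle_iff.2 h hij)

/-- `addHook` truncates to the new box, so the box condition on `μ` is what ensures that no shifted
cell is lost. -/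
theorem succ_mem_addHook {a b i j : ℕ} {μ : YoungDiagram} (h : (a, 0) ∉ μ ∧ (0, b) ∉ μ) :
    (i + 1, j + 1) ∈ addHook a b μ ↔ (i, j) ∈ μ := by
  rw [mem_addHook]
  constructor
  · rintro ⟨_, h0 | h0 | h0⟩
    · omega
    · omega
    · exact h0
  · intro hij
    have := lt_of_mem h hij
    exact ⟨by omega, Or.inr (Or.inr hij)⟩

theorem removeHook_addHook {a b : ℕ} {μ : YoungDiagram} (h : (a, 0) ∉ μ ∧ (0, b) ∉ μ) :
    removeHook (addHook a b μ) = μ := by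
  refine YoungDiagram.ext (Finset.ext ?_)
  rintro ⟨i, j⟩
  rw [YoungDiagram.mem_cells, YoungDiagram.mem_cells, mem_removeHook, succ_mem_addHook h]

theorem addHook_removeHook {a b : ℕ} {μ : YoungDiagram} (h : (a + 1, 0) ∉ μ ∧ (0, b + 1) ∉ μ)
    (ha : (a, 0) ∈ μ) (hb : (0, b) ∈ μ) : addHook a b (removeHook μ) = μ := by
  refine YoungDiagram.ext (Finset.ext ?_)
  rintro ⟨i, j⟩
  rw [YoungDiagram.mem_cells, YoungDiagram.mem_cells, mem_addHook]
  constructor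
  · rintro ⟨h1, rfl | rfl | h0⟩
    · exact μ.up_left_mem le_rfl (by omega) hb
    · exact μ.up_left_mem (by omega) le_rfl ha
    · rw [mem_removeHook] at h0
      exact μ.up_left_mem (by omega) (by omega) h0
  · intro hij
    refine ⟨lt_of_mem h hij, ?_⟩
    rcases i with _ | i
    · exact Or.inl rfl
    rcases j with _ | j
    · exact Or.inr (Or.inl rfl)
    exact Or.inr (Or.inr (mem_removeHook.2 hij))

theorem rowLen_succ_addHook {a b i : ℕ} {μ : YoungDiagram} (h : (a, 0) ∉ μ ∧ (0, b) ∉ μ)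
    (hi : i < a) : (addHook a b μ).rowLen (i + 1) = μ.rowLen i + 1 := by
  refine eq_of_forall_lt_iff fun j => ?_
  rw [← YoungDiagram.mem_iff_lt_rowLen]
  rcases j with _ | j
  · simp [mem_addHook, hi]
  · rw [succ_mem_addHook h, YoungDiagram.mem_iff_lt_rowLen]
    omega

theorem colLen_succ_addHook {a b j : ℕ} {μ : YoungDiagram} (h : (a, 0) ∉ μ ∧ (0, b) ∉ μ)
    (hj : j < b) : (addHook a b μ).colLen (j + 1) = μ.colLen j + 1 := by
  refine eq_of_forall_lt_iff fun i => ?_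
  rw [← YoungDiagram.mem_iff_lt_colLen]
  rcases i with _ | i
  · simp [mem_addHook, hj]
  · rw [succ_mem_addHook h, YoungDiagram.mem_iff_lt_colLen]
    omega

theorem rowLen_zero_addHook (a b : ℕ) (μ : YoungDiagram) :
    (addHook a b μ).rowLen 0 = b + 1 := by
  refine eq_of_forall_lt_iff fun j => ?_
  rw [← YoungDiagram.mem_iff_lt_rowLen, mem_addHook]
  simp

theorem colLen_zero_addHook (a b : ℕ) (μ : YoungDiagram) :
    (addHook a b μ).colLen 0 = a + 1 := by
  refine eq_of_forall_lt_iff fun j => ?_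
  rw [← YoungDiagram.mem_iff_lt_colLen, mem_addHook]
  simp

theorem durfee_addHook {a b : ℕ} {μ : YoungDiagram} (h : (a, 0) ∉ μ ∧ (0, b) ∉ μ) :
    durfee (addHook a b μ) = durfee μ + 1 := by
  refine eq_of_forall_lt_iff fun i => ?_
  rw [← diag_mem_iff]
  rcases i with _ | i
  · simp [mem_addHook]
  · rw [succ_mem_addHook h, diag_mem_iff]
    omega

theorem card_addHook {a b : ℕ} {μ : YoungDiagram} (h : (a, 0) ∉ μ ∧ (0, b) ∉ μ) :
    (addHook a b μ).card = μ.card + (a + b + 1) := by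
  -- The shifted copy of `μ`, the full first column, and the first row without its corner.
  have hc : (addHook a b μ).cells =
      μ.cells.image (fun p => (p.1 + 1, p.2 + 1)) ∪
        ((Finset.range (a + 1)).image (fun i => (i, 0)) ∪
          (Finset.range b).image (fun j => (0, j + 1))) := by
    ext ⟨i, j⟩
    rw [YoungDiagram.mem_cells]
    rcases i with _ | i <;> rcases j with _ | j
    · simp [mem_addHook]
    · simp [mem_addHook]
    · simp [mem_addHook]
    · simp [succ_mem_addHook h]
  have hs : Function.Injective (fun p : ℕ × ℕ => (p.1 + 1, p.2 + 1)) := by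
    rintro ⟨i, j⟩ ⟨i', j'⟩ hp
    simpa using hp
  have h1 : Function.Injective (fun i : ℕ => (i, 0)) := fun i i' hp => by simpa using hp
  have h2 : Function.Injective (fun j : ℕ => (0, j + 1)) := fun i i' hp => by simpa using hp
  rw [YoungDiagram.card, hc, Finset.card_union_of_disjoint, Finset.card_union_of_disjoint,
    Finset.card_image_of_injective _ hs, Finset.card_image_of_injective _ h1,
    Finset.card_image_of_injective _ h2, Finset.card_range, Finset.card_range]
  · ring_nf
  · rw [Finset.disjoint_left]
    rintro ⟨i, j⟩ h3 h4
    simp only [Finset.mem_image, Prod.mk.injEq] at h3 h4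
    obtain ⟨_, _, h3⟩ := h3
    obtain ⟨_, _, h4⟩ := h4
    omega
  · rw [Finset.disjoint_left]
    rintro ⟨i, j⟩ h3 h4
    simp only [Finset.mem_image, Finset.mem_union, Prod.mk.injEq] at h3 h4
    obtain ⟨_, _, h3⟩ := h3
    obtain ⟨_, _, h4⟩ | ⟨_, _, h4⟩ := h4 <;> omega

/-- The new first rank is `b - a`, negative because `b < a`; every old row and column meeting the
box grows by one, so the old ranks survive with index shifted. -/
theorem addHook_mem_negRankBox {a b : ℕ} (hab : b < a) {μ : YoungDiagram}
    (h : μ ∈ negRankBox a b) : addHook a b μ ∈ negRankBox (a + 1) (b + 1) := by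
  rw [mem_negRankBox] at h ⊢
  refine ⟨by simp [mem_addHook], fun i hi => ?_⟩
  rcases i with _ | i
  · rw [rowLen_zero_addHook, colLen_zero_addHook]
    omega
  · rw [succ_mem_addHook h.1] at hi
    have hlt := lt_of_mem h.1 hi
    rw [rowLen_succ_addHook h.1 hlt.1, colLen_succ_addHook h.1 hlt.2]
    exact Nat.succ_lt_succ (h.2 i hi)

theorem removeHook_mem_negRankBox {a b : ℕ} {μ : YoungDiagram}
    (h : μ ∈ negRankBox (a + 1) (b + 1)) (ha : (a, 0) ∈ μ) (hb : (0, b) ∈ μ) :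
    removeHook μ ∈ negRankBox a b := by
  rw [mem_negRankBox] at h ⊢
  have hbox : (a, 0) ∉ removeHook μ ∧ (0, b) ∉ removeHook μ := by
    rw [mem_removeHook, mem_removeHook]
    exact ⟨fun h' => h.1.1 (μ.up_left_mem le_rfl (by omega) h'),
      fun h' => h.1.2 (μ.up_left_mem (by omega) le_rfl h')⟩
  refine ⟨hbox, fun i hi => ?_⟩
  have hlt := lt_of_mem hbox hi
  have := h.2 (i + 1) (mem_removeHook.1 hi)
  rw [← addHook_removeHook h.1 ha hb, rowLen_succ_addHook hbox hlt.1,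
    colLen_succ_addHook hbox hlt.2] at this
  omega

/-! ### Recurrence for the diagram generating function -/

section Recurrence

variable {K : Type*} [CommRing K] (x y : K)

/-- The generating function of `negRankBox a b` by size and Durfee square. -/
noncomputable def boxSum (a b : ℕ) : K := ∑ μ ∈ negRankBox a b, x ^ μ.card * y ^ durfee μ

theorem boxSum_zero_right (a : ℕ) : boxSum x y a 0 = 1 := by
  have hbot : ∀ μ : YoungDiagram, (0, 0) ∉ μ → μ = ⊥ := by
    intro μ h
    rw [← le_bot_iff]
    rintro ⟨i, j⟩ hij
    exact absurd (μ.up_left_mem (Nat.zero_le _) (Nat.zero_le _) hij) h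
  have h : negRankBox a 0 = {⊥} := by
    ext μ
    rw [mem_negRankBox, Finset.mem_singleton]
    constructor
    · exact fun h => hbot μ h.1.2
    · rintro rfl
      simp
  have hd : durfee ⊥ = 0 := by
    by_contra h0
    exact YoungDiagram.notMem_bot _ (diag_mem_iff.2 (Nat.pos_of_ne_zero h0))
  rw [boxSum, h, Finset.sum_singleton, hd]
  simp [YoungDiagram.card]

/-- A first row of length `b + 1` would need a first column longer than the box, since the first
rank is negative. -/
theorem boxSum_succ_self (b : ℕ) : boxSum x y (b + 1) (b + 1) = boxSum x y (b + 1) b := by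
  refine Finset.sum_congr (Finset.ext fun μ => ?_) fun _ _ => rfl
  rw [mem_negRankBox, mem_negRankBox]
  constructor
  · rintro ⟨h1, h2⟩
    refine ⟨⟨h1.1, fun h => ?_⟩, h2⟩
    have h3 := h2 0 (μ.up_left_mem le_rfl (Nat.zero_le _) h)
    rw [YoungDiagram.mem_iff_lt_rowLen] at h
    have h4 := h1.1
    rw [YoungDiagram.mem_iff_lt_colLen] at h4
    omega
  · rintro ⟨h1, h2⟩
    exact ⟨⟨h1.1, fun h => h1.2 (μ.up_left_mem le_rfl (Nat.le_succ _) h)⟩, h2⟩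

theorem boxSum_succ_succ {a b : ℕ} (hab : b < a) :
    boxSum x y (a + 1) (b + 1) = boxSum x y a (b + 1) + boxSum x y (a + 1) b +
      (x ^ (a + b + 1) * y - 1) * boxSum x y a b := by
  classical
  have hrow : ∀ μ : YoungDiagram, (a, 0) ∉ μ → (a + 1, 0) ∉ μ :=
    fun μ h h' => h (μ.up_left_mem (Nat.le_succ _) le_rfl h')
  have hcol : ∀ μ : YoungDiagram, (0, b) ∉ μ → (0, b + 1) ∉ μ :=
    fun μ h h' => h (μ.up_left_mem le_rfl (Nat.le_succ _) h')
  have hinter : negRankBox a (b + 1) ∩ negRankBox (a + 1) b = negRankBox a b := by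
    ext μ
    simp only [Finset.mem_inter, mem_negRankBox]
    have := hrow μ
    have := hcol μ
    tauto
  have hunion : negRankBox a (b + 1) ∪ negRankBox (a + 1) b =
      {μ ∈ negRankBox (a + 1) (b + 1) | ¬ ((a, 0) ∈ μ ∧ (0, b) ∈ μ)} := by
    ext μ
    simp only [Finset.mem_union, Finset.mem_filter, mem_negRankBox]
    have := hrow μ
    have := hcol μ
    tauto
  have hhook : ∑ μ ∈ negRankBox (a + 1) (b + 1) with (a, 0) ∈ μ ∧ (0, b) ∈ μ,
      x ^ μ.card * y ^ durfee μ = x ^ (a + b + 1) * y * boxSum x y a b := by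
    rw [boxSum, Finset.mul_sum]
    refine Finset.sum_bij' (fun μ _ => removeHook μ) (fun μ _ => addHook a b μ) ?_ ?_ ?_ ?_ ?_
    · intro μ hμ
      rw [Finset.mem_filter] at hμ
      exact removeHook_mem_negRankBox hμ.1 hμ.2.1 hμ.2.2
    · intro μ hμ
      rw [Finset.mem_filter]
      refine ⟨addHook_mem_negRankBox hab hμ, ?_⟩
      simp [mem_addHook]
    · intro μ hμ
      rw [Finset.mem_filter] at hμ
      exact addHook_removeHook (mem_negRankBox.1 hμ.1).1 hμ.2.1 hμ.2.2
    · intro μ hμ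
      exact removeHook_addHook (mem_negRankBox.1 hμ).1
    · intro μ hμ
      rw [Finset.mem_filter] at hμ
      have hbox := (mem_negRankBox.1 (removeHook_mem_negRankBox hμ.1 hμ.2.1 hμ.2.2)).1
      conv_lhs => rw [← addHook_removeHook (mem_negRankBox.1 hμ.1).1 hμ.2.1 hμ.2.2]
      rw [card_addHook hbox, durfee_addHook hbox]
      ring
  have hie := Finset.sum_union_inter (s₁ := negRankBox a (b + 1)) (s₂ := negRankBox (a + 1) b)
    (f := fun μ => x ^ μ.card * y ^ durfee μ)
  rw [hinter, hunion] at hie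
  have hsplit := Finset.sum_filter_add_sum_filter_not (negRankBox (a + 1) (b + 1))
    (fun μ => (a, 0) ∈ μ ∧ (0, b) ∈ μ) (fun μ => x ^ μ.card * y ^ durfee μ)
  rw [hhook] at hsplit
  simp only [boxSum] at hie hsplit ⊢
  linear_combination hie - hsplit

end Recurrence

/-! ### Ballot words -/

theorem Des_concat_concat (w : List ℕ+) (i j : ℕ+) :
    Des (w ++ [i] ++ [j]) =
      if j < i then insert (w.length + 1) (Des (w ++ [i])) else Des (w ++ [i]) := by
  have key : ∀ k, k ∈ Des (w ++ [i] ++ [j]) ↔ k ∈ Des (w ++ [i]) ∨ k = w.length + 1 ∧ j < i := by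
    intro k
    simp only [Des, Finset.mem_filter, Finset.mem_Ico, List.length_append, List.length_singleton]
    -- The letters compared at `k` both lie in `w ++ [i]`, or are `i` and `j`, or `k` is too large
    -- to be a descent.
    rcases lt_trichotomy k (w.length + 1) with hk | rfl | hk
    · rw [List.getD_append _ _ _ k (by simpa using hk),
        List.getD_append _ _ _ (k - 1) (by simp; omega)]
      constructor
      · rintro ⟨h1, h2⟩
        exact Or.inl ⟨by omega, h2⟩
      · rintro (⟨h1, h2⟩ | h)
        · exact ⟨by omega, h2⟩
        · omega
    · simp
    · constructor
      · rintro ⟨h1, _⟩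
        omega
      · rintro (⟨h1, _⟩ | h) <;> omega
  ext k
  rw [key]
  split_ifs with h <;> simp [h, or_comm]

theorem Des_singleton (i : ℕ+) : Des [i] = Des [] := by
  simp [Des]

theorem length_notMem_Des (w : List ℕ+) : w.length ∉ Des w := by
  simp [Des]

theorem isBallot_concat {w : List ℕ+} {j : ℕ+} :
    IsBallot (w ++ [j]) ↔
      IsBallot w ∧ ∀ i : ℕ+, (w ++ [j]).count (i + 1) ≤ (w ++ [j]).count i := by
  constructor
  · intro h
    exact ⟨fun v hv => h v (hv.trans (List.prefix_append _ _)), h _ List.prefix_rfl⟩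
  · rintro ⟨h1, h2⟩ v hv
    rcases List.prefix_concat_iff.1 hv with rfl | hv
    · exact h2
    · exact h1 v hv

open Classical in
/-- The ballot words with `a` ones and `b` twos. -/
noncomputable def ballotWords (a b : ℕ) : Finset (List ℕ+) :=
  {w ∈ (List.replicate a (1 : ℕ+) ++ List.replicate b 2).permutations.toFinset | IsBallot w}

theorem mem_ballotWords {a b : ℕ} {w : List ℕ+} :
    w ∈ ballotWords a b ↔
      ((∀ i, i ≠ 1 → i ≠ 2 → w.count i = 0) ∧ w.count 1 = a ∧ w.count 2 = b) ∧ IsBallot w := by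
  have h12 : (1 : ℕ+) ≠ 2 := by decide
  simp only [ballotWords, Finset.mem_filter, List.mem_toFinset, List.mem_permutations,
    List.perm_iff_count, List.count_append, List.count_replicate]
  refine and_congr_left fun _ => ?_
  constructor
  · intro h
    refine ⟨fun i h1 h2 => ?_, ?_, ?_⟩
    · rw [h]; simp [h1.symm, h2.symm]
    · rw [h]; simp [h12.symm]
    · rw [h]; simp [h12]
  · rintro ⟨h0, h1, h2⟩ i
    by_cases hi1 : i = 1
    · subst hi1; simp [h1, h12.symm]
    by_cases hi2 : i = 2
    · subst hi2; simp [h2, h12]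
    simp [h0 i hi1 hi2, Ne.symm hi1, Ne.symm hi2]

theorem B_eq_ballotWords (n : ℕ) : B n = ballotWords n n := rfl

theorem length_of_mem_ballotWords {a b : ℕ} {w : List ℕ+} (h : w ∈ ballotWords a b) :
    w.length = a + b := by
  classical
  simp only [ballotWords, Finset.mem_filter, List.mem_toFinset, List.mem_permutations] at h
  simpa using h.1.length_eq

theorem concat_one_mem_ballotWords {a b : ℕ} {w : List ℕ+} :
    w ++ [1] ∈ ballotWords (a + 1) b ↔ w ∈ ballotWords a b := by
  have h12 : (1 : ℕ+) ≠ 2 := by decide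
  simp only [mem_ballotWords, isBallot_concat, List.count_append, List.count_singleton]
  constructor
  · rintro ⟨⟨h0, h1, h2⟩, h3, -⟩
    refine ⟨⟨fun i hi1 hi2 => ?_, ?_, ?_⟩, h3⟩
    · have := h0 i hi1 hi2; omega
    · simpa using h1
    · simpa [h12] using h2
  · rintro ⟨⟨h0, h1, h2⟩, h3⟩
    refine ⟨⟨fun i hi1 hi2 => ?_, by simpa using h1, by simpa [h12] using h2⟩, h3, fun i => ?_⟩
    · simp [h0 i hi1 hi2, Ne.symm hi1]
    · have hb := h3 w List.prefix_rfl i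
      have hi : (1 : ℕ+) ≠ i + 1 := (PNat.lt_add_left 1 i).ne
      simp only [beq_iff_eq, hi, if_false]
      omega

/-- For the extended word the only new ballot inequality is `b + 1 ≤ a`, between twos and ones. -/
theorem concat_two_mem_ballotWords {a b : ℕ} (hab : b < a) {w : List ℕ+} :
    w ++ [2] ∈ ballotWords a (b + 1) ↔ w ∈ ballotWords a b := by
  have h12 : (2 : ℕ+) ≠ 1 := by decide
  simp only [mem_ballotWords, isBallot_concat, List.count_append, List.count_singleton]
  constructor
  · rintro ⟨⟨h0, h1, h2⟩, h3, -⟩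
    refine ⟨⟨fun i hi1 hi2 => ?_, ?_, ?_⟩, h3⟩
    · have := h0 i hi1 hi2; omega
    · simpa [h12] using h1
    · simpa using h2
  · rintro ⟨⟨h0, h1, h2⟩, h3⟩
    refine ⟨⟨fun i hi1 hi2 => ?_, by simpa [h12] using h1, by simpa using h2⟩, h3, fun i => ?_⟩
    · simp [h0 i hi1 hi2, Ne.symm hi2]
    · have hb := h3 w List.prefix_rfl i
      by_cases hi : i = 1
      · subst hi
        have : (1 : ℕ+) + 1 = 2 := rfl
        simp only [this, h1, h2, beq_self_eq_true, if_true]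
        omega
      · have hi' : (2 : ℕ+) ≠ i + 1 := fun h => hi (add_right_cancel (b := 1) h.symm)
        simp only [beq_iff_eq, hi', if_false]
        omega

theorem eq_concat_of_mem_ballotWords {a b : ℕ} {w : List ℕ+} (h : w ∈ ballotWords a (b + 1)) :
    (∃ v, w = v ++ [1]) ∨ ∃ v, w = v ++ [2] := by
  rw [mem_ballotWords] at h
  obtain ⟨⟨h0, -, h2⟩, -⟩ := h
  rcases List.eq_nil_or_concat' w with rfl | ⟨v, i, rfl⟩
  · simp at h2
  by_cases hi1 : i = 1
  · exact Or.inl ⟨v, by rw [hi1]⟩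
  by_cases hi2 : i = 2
  · exact Or.inr ⟨v, by rw [hi2]⟩
  have := h0 i hi1 hi2
  simp at this

theorem le_of_mem_ballotWords {a b : ℕ} {w : List ℕ+} (h : w ∈ ballotWords a b) : b ≤ a := by
  rw [mem_ballotWords] at h
  have := h.2 w List.prefix_rfl 1
  rwa [show (1 : ℕ+) + 1 = 2 from rfl, h.1.2.1, h.1.2.2] at this

theorem concat_injective (j : ℕ+) : Function.Injective (fun w : List ℕ+ => w ++ [j]) :=
  fun _ _ h => List.append_cancel_right h

theorem concat_one_ne_concat_two (v w : List ℕ+) : v ++ [1] ≠ w ++ [2] := by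
  intro h
  have := (List.append_inj' h rfl).2
  simp at this

theorem Des_concat_two (w : List ℕ+) (hw : ∀ i, i ≠ 1 → i ≠ 2 → w.count i = 0) :
    Des (w ++ [2]) = Des w := by
  rcases List.eq_nil_or_concat' w with rfl | ⟨v, i, rfl⟩
  · exact Des_singleton 2
  · by_cases hi1 : i = 1
    · subst hi1; rw [Des_concat_concat, if_neg (by decide)]
    by_cases hi2 : i = 2
    · subst hi2; rw [Des_concat_concat, if_neg (by decide)]
    have := hw i hi1 hi2
    simp at this

/-! ### Recurrence for the ballot word generating function -/

section Recurrence

variable {K : Type*} [CommRing K] (x y : K)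

/-- The generating function of `ballotWords a b` by major index and descent number. -/
noncomputable def ballotSum (a b : ℕ) : K := ∑ w ∈ ballotWords a b, x ^ maj w * y ^ des w

theorem ballotSum_zero_right (a : ℕ) : ballotSum x y a 0 = 1 := by
  have h : ∀ a, ballotWords a 0 = {List.replicate a 1} := by
    intro a
    ext w
    classical
    simp only [ballotWords, Finset.mem_filter, List.mem_toFinset, List.mem_permutations,
      List.replicate_zero, List.append_nil, List.perm_replicate, Finset.mem_singleton,
      and_iff_left_iff_imp]
    rintro rfl v hv i
    rw [List.prefix_replicate_iff] at hv
    rw [hv.2, List.count_replicate, List.count_replicate]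
    have hi : (1 : ℕ+) ≠ i + 1 := (PNat.lt_add_left 1 i).ne
    simp [hi]
  have hD : Des (List.replicate a (1 : ℕ+)) = ∅ := by
    rw [Des, Finset.filter_eq_empty_iff]
    intro i hi
    simp only [Finset.mem_Ico, List.length_replicate] at hi
    rw [List.getD_eq_getElem _ _ (by simp; omega), List.getD_eq_getElem _ _ (by simp; omega)]
    simp
  rw [ballotSum, h, Finset.sum_singleton, maj, des, hD]
  simp

theorem sum_ballotWords_succ {a b : ℕ} (hab : b < a) (f : List ℕ+ → K) :
    ∑ w ∈ ballotWords (a + 1) (b + 1), f w =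
      ∑ w ∈ ballotWords a (b + 1), f (w ++ [1]) + ∑ w ∈ ballotWords (a + 1) b, f (w ++ [2]) := by
  classical
  have h : ballotWords (a + 1) (b + 1) =
      (ballotWords a (b + 1)).image (fun w => w ++ [1]) ∪
        (ballotWords (a + 1) b).image (fun w => w ++ [2]) := by
    ext w
    simp only [Finset.mem_union, Finset.mem_image]
    constructor
    · intro hw
      rcases eq_concat_of_mem_ballotWords hw with ⟨v, rfl⟩ | ⟨v, rfl⟩
      · exact Or.inl ⟨v, concat_one_mem_ballotWords.1 hw, rfl⟩
      · exact Or.inr ⟨v, (concat_two_mem_ballotWords (by omega)).1 hw, rfl⟩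
    · rintro (⟨v, hv, rfl⟩ | ⟨v, hv, rfl⟩)
      · exact concat_one_mem_ballotWords.2 hv
      · exact (concat_two_mem_ballotWords (by omega)).2 hv
  rw [h, Finset.sum_union, Finset.sum_image fun _ _ _ _ h => concat_injective 1 h,
    Finset.sum_image fun _ _ _ _ h => concat_injective 2 h]
  rw [Finset.disjoint_left]
  intro w h1 h2
  simp only [Finset.mem_image] at h1 h2
  obtain ⟨v, -, rfl⟩ := h1
  obtain ⟨u, -, h2⟩ := h2
  exact concat_one_ne_concat_two v u h2.symm

theorem sum_concat_two {a b : ℕ} :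
    ∑ w ∈ ballotWords a b, x ^ maj (w ++ [2]) * y ^ des (w ++ [2]) = ballotSum x y a b := by
  refine Finset.sum_congr rfl fun w hw => ?_
  rw [maj, des, Des_concat_two w (mem_ballotWords.1 hw).1.1, ← maj, ← des]

/-- A balanced ballot word must end in 2: deleting a final 1 would leave a prefix with more twos
than ones. Appending 2 is therefore a bijection, and it keeps the descent set. -/
theorem ballotSum_succ_self (b : ℕ) :
    ballotSum x y (b + 1) (b + 1) = ballotSum x y (b + 1) b := by
  rw [← sum_concat_two x y (a := b + 1) (b := b), ballotSum]
  symm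
  refine Finset.sum_bij (fun w _ => w ++ [2]) ?_ ?_ ?_ ?_
  · exact fun w hw => (concat_two_mem_ballotWords (by omega)).2 hw
  · exact fun v _ w _ h => concat_injective 2 h
  · intro w hw
    rcases eq_concat_of_mem_ballotWords hw with ⟨v, rfl⟩ | ⟨v, rfl⟩
    · have := le_of_mem_ballotWords (concat_one_mem_ballotWords.1 hw)
      omega
    · exact ⟨v, (concat_two_mem_ballotWords (by omega)).1 hw, rfl⟩
  · exact fun _ _ => rfl

theorem ballotSum_succ_succ {a b : ℕ} (hab : b < a) :
    ballotSum x y (a + 1) (b + 1) = ballotSum x y a (b + 1) + ballotSum x y (a + 1) b +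
      (x ^ (a + b + 1) * y - 1) * ballotSum x y a b := by
  classical
  -- The change caused by appending 1 vanishes on words ending in 1, so only the words `w ++ [2]`
  -- with `w` in `ballotWords a b` contribute; these gain the descent `a + b + 1`.
  have hdiff : ∑ w ∈ ballotWords a (b + 1),
      (x ^ maj (w ++ [1]) * y ^ des (w ++ [1]) - x ^ maj w * y ^ des w) =
      ∑ w ∈ ballotWords a b, (x ^ (a + b + 1) * y - 1) * (x ^ maj w * y ^ des w) := by
    symm
    refine Finset.sum_of_injOn (fun w => w ++ [2]) (concat_injective 2).injOn ?_ ?_ ?_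
    · exact fun w hw => (concat_two_mem_ballotWords hab).2 hw
    · intro w hw hw'
      rcases eq_concat_of_mem_ballotWords hw with ⟨v, rfl⟩ | ⟨v, rfl⟩
      · have : Des (v ++ [1] ++ [1]) = Des (v ++ [1]) := by
          rw [Des_concat_concat, if_neg (lt_irrefl _)]
        rw [maj, des, this, ← maj, ← des, sub_self]
      · exact absurd ⟨v, (concat_two_mem_ballotWords hab).1 hw, rfl⟩ hw'
    · intro w hw
      have hl := length_of_mem_ballotWords hw
      have h2 := Des_concat_two w (mem_ballotWords.1 hw).1.1
      have hn : a + b + 1 ∉ Des w := by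
        have := length_notMem_Des (w ++ [2])
        rwa [h2, List.length_append, hl] at this
      have h1 : Des (w ++ [2] ++ [1]) = insert (a + b + 1) (Des w) := by
        rw [Des_concat_concat, if_pos (by decide), hl, h2]
      simp only [maj, des, h1, h2, Finset.sum_insert hn, Finset.card_insert_of_notMem hn]
      ring
  rw [Finset.sum_sub_distrib, ← Finset.mul_sum] at hdiff
  have hsum := sum_ballotWords_succ hab (fun w => x ^ maj w * y ^ des w)
  rw [sum_concat_two] at hsum
  simp only [ballotSum] at hsum ⊢
  linear_combination hsum + hdiff

/-- Induction on `b`, then on `a` from `b + 1`, never leaves the region `b ≤ a`: the boundary rule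
starts each inner induction. -/
theorem eq_of_recurrence {f g : ℕ → ℕ → K} (u : ℕ → ℕ → K)
    (hf0 : ∀ a, f a 0 = g a 0)
    (hf1 : ∀ b, f (b + 1) (b + 1) = f (b + 1) b) (hg1 : ∀ b, g (b + 1) (b + 1) = g (b + 1) b)
    (hf : ∀ a b, b < a →
      f (a + 1) (b + 1) = f a (b + 1) + f (a + 1) b + u a b * f a b)
    (hg : ∀ a b, b < a →
      g (a + 1) (b + 1) = g a (b + 1) + g (a + 1) b + u a b * g a b) :
    ∀ b a, b ≤ a → f a b = g a b := by
  intro b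
  induction b with
  | zero => exact fun a _ => hf0 a
  | succ b ihb =>
    intro a hab
    induction a, hab using Nat.le_induction with
    | base => rw [hf1, hg1, ihb _ (Nat.le_succ b)]
    | succ a hab iha => rw [hf a b hab, hg a b hab, iha, ihb _ (by omega), ihb _ (by omega)]

theorem boxSum_eq_ballotSum {a b : ℕ} (hab : b ≤ a) : boxSum x y a b = ballotSum x y a b :=
  eq_of_recurrence (fun a b => x ^ (a + b + 1) * y - 1)
    (fun a => by rw [boxSum_zero_right, ballotSum_zero_right])
    (boxSum_succ_self x y) (ballotSum_succ_self x y)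
    (fun _ _ => boxSum_succ_succ x y) (fun _ _ => ballotSum_succ_succ x y) b a hab

end Recurrence

/-! ### The closed form at `t = 1` -/

theorem qNumber_mul_sub_one (n : ℕ) : qNumber n * (RatFunc.X - 1) = RatFunc.X ^ n - 1 :=
  geom_sum_mul _ _

theorem X_pow_succ_sub_one_ne_zero (n : ℕ) : (RatFunc.X : RatFunc ℚ) ^ (n + 1) - 1 ≠ 0 := by
  have h : (RatFunc.X : RatFunc ℚ) ^ (n + 1) - 1 =
      algebraMap (Polynomial ℚ) (RatFunc ℚ) (Polynomial.X ^ (n + 1) - Polynomial.C 1) := by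
    simp
  rw [h, Ne, FaithfulSMul.algebraMap_eq_zero_iff]
  exact Polynomial.X_pow_sub_C_ne_zero n.succ_pos 1

theorem X_sub_one_ne_zero : (RatFunc.X : RatFunc ℚ) - 1 ≠ 0 := by
  simpa using X_pow_succ_sub_one_ne_zero 0

theorem qNumber_succ_ne_zero (n : ℕ) : qNumber (n + 1) ≠ 0 := by
  intro h
  have := qNumber_mul_sub_one (n + 1)
  rw [h, zero_mul] at this
  exact X_pow_succ_sub_one_ne_zero n this.symm

theorem qFactorial_succ (n : ℕ) : qFactorial (n + 1) = qFactorial n * qNumber (n + 1) :=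
  Finset.prod_Icc_succ_top (by omega) _

theorem qFactorial_ne_zero (n : ℕ) : qFactorial n ≠ 0 := by
  induction n with
  | zero => simp [qFactorial]
  | succ n ih => rw [qFactorial_succ]; exact mul_ne_zero ih (qNumber_succ_ne_zero n)

theorem qNumber_eq (n : ℕ) : qNumber n = (RatFunc.X ^ n - 1) / (RatFunc.X - 1) :=
  eq_div_of_mul_eq X_sub_one_ne_zero (qNumber_mul_sub_one n)

/-- The `q`-analogue of the ballot number for words with `a` ones and `b` twos. -/
noncomputable def qBallot (a b : ℕ) : RatFunc ℚ :=
  qFactorial (a + b) * (qNumber (a + 1) - RatFunc.X * qNumber b) /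
    (qFactorial (a + 1) * qFactorial b)

theorem qBallot_zero_right (a : ℕ) : qBallot a 0 = 1 := by
  have h0 : qFactorial 0 = 1 := by simp [qFactorial]
  have h1 : qNumber 0 = 0 := by simp [qNumber]
  have := qFactorial_ne_zero a
  have := qNumber_succ_ne_zero a
  rw [qBallot, qFactorial_succ, h0, h1, add_zero]
  field_simp
  ring

theorem qBallot_succ_self (b : ℕ) : qBallot (b + 1) (b + 1) = qBallot (b + 1) b := by
  have h1 := qFactorial_ne_zero b
  have h2 := qNumber_succ_ne_zero b
  have h3 := qFactorial_ne_zero (b + 1 + 1)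
  have h4 := X_sub_one_ne_zero
  rw [qBallot, qBallot, ← add_assoc, qFactorial_succ (b + 1 + b), qFactorial_succ b]
  -- What remains after cancelling factorials; it becomes a polynomial identity in powers of `X`
  -- once each `[m]` is `(X^m - 1)/(X - 1)`.
  have key : qNumber (b + 1 + b + 1) * (qNumber (b + 1 + 1) - RatFunc.X * qNumber (b + 1)) =
      qNumber (b + 1) * (qNumber (b + 1 + 1) - RatFunc.X * qNumber b) := by
    simp only [qNumber_eq]
    field_simp
    ring
  rw [div_eq_div_iff (by positivity) (by positivity)]
  linear_combination (qFactorial (b + 1 + b) * qFactorial (b + 1 + 1) * qFactorial b) * key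

/-- The factor `* 1` is the specialization `y = 1`, kept so that the coefficient matches
`boxSum_succ_succ`. -/
theorem qBallot_succ_succ (a b : ℕ) :
    qBallot (a + 1) (b + 1) = qBallot a (b + 1) + qBallot (a + 1) b +
      (RatFunc.X ^ (a + b + 1) * 1 - 1) * qBallot a b := by
  have h1 := qFactorial_ne_zero b
  have h2 := qNumber_succ_ne_zero b
  have h3 := qFactorial_ne_zero a
  have h4 := qNumber_succ_ne_zero a
  have h5 := qNumber_succ_ne_zero (a + 1)
  have h6 := X_sub_one_ne_zero
  simp only [qBallot]
  rw [show a + 1 + (b + 1) = a + b + 1 + 1 by ring, show a + (b + 1) = a + b + 1 by ring,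
    show a + 1 + b = a + b + 1 by ring]
  simp only [qFactorial_succ]
  -- The recurrence with denominators cleared and the common factor `[a+b]!` removed.
  have key : qNumber (a + b + 1) * qNumber (a + b + 1 + 1) *
        (qNumber (a + 1 + 1) - RatFunc.X * qNumber (b + 1)) =
      qNumber (a + b + 1) * qNumber (a + 1 + 1) *
        (qNumber (a + 1) - RatFunc.X * qNumber (b + 1)) +
      qNumber (a + b + 1) * qNumber (b + 1) * (qNumber (a + 1 + 1) - RatFunc.X * qNumber b) +
      (RatFunc.X ^ (a + b + 1) - 1) * qNumber (a + 1 + 1) * qNumber (b + 1) *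
        (qNumber (a + 1) - RatFunc.X * qNumber b) := by
    simp only [qNumber_eq]
    field_simp
    ring
  field_simp
  linear_combination qFactorial (a + b) * key

theorem boxSum_one_eq_qBallot {a b : ℕ} (hab : b ≤ a) :
    boxSum (RatFunc.X : RatFunc ℚ) 1 a b = qBallot a b :=
  eq_of_recurrence (fun a b => RatFunc.X ^ (a + b + 1) * 1 - 1)
    (fun a => by rw [boxSum_zero_right, qBallot_zero_right])
    (boxSum_succ_self _ _) qBallot_succ_self
    (fun _ _ => boxSum_succ_succ _ _) (fun a b _ => qBallot_succ_succ a b) b a hab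

theorem qBallot_self (n : ℕ) : qBallot n n = 1 / qNumber (n + 1) * qBinomial (2 * n) n := by
  have h1 := qFactorial_ne_zero n
  have h2 := qNumber_succ_ne_zero n
  -- On the diagonal the numerator factor of the `q`-ballot number collapses, leaving the
  -- `q`-Catalan number.
  have h3 : qNumber (n + 1) - RatFunc.X * qNumber n = 1 := by
    have h4 := X_sub_one_ne_zero
    simp only [qNumber_eq]
    field_simp
    ring
  rw [qBallot, h3, qBinomial, qFactorial_succ, ← two_mul, show 2 * n - n = n by omega]
  field_simp

end QTCatalan

theorem mainTheorem4 (n : ℕ) :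
    (∑ μ ∈ QTCatalan.R n, QTCatalan.q ^ μ.card * QTCatalan.t ^ QTCatalan.durfee μ
      = QTCatalan.c n) ∧
    (∑ μ ∈ QTCatalan.R n, (RatFunc.X : RatFunc ℚ) ^ μ.card
      = 1 / QTCatalan.qNumber (n + 1) * QTCatalan.qBinomial (2 * n) n) := by
  rw [QTCatalan.R_eq_negRankBox, QTCatalan.c, QTCatalan.B_eq_ballotWords]
  refine ⟨QTCatalan.boxSum_eq_ballotSum QTCatalan.q QTCatalan.t le_rfl, ?_⟩
  rw [← QTCatalan.qBallot_self, ← QTCatalan.boxSum_one_eq_qBallot le_rfl, QTCatalan.boxSum]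
  simp
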